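/- Let $G$ be a finite-dimensional real Lie group with Lie algebra $\mathfrak g=T_eG$, whose bracket $[\cdot,\cdot]$ is the one obtained from right-invariant vector fields: $[\xi,\eta]=[X_\xi,X_\eta](e)$ with $X_\xi(g)=T_eR_g\,\xi$, where $R_gh=hg$. For $\xi\in\mathfrak g$, $\mu\in\mathfrak g^*$ put $\mathrm{ad}_\xi\eta=[\xi,\eta]$ and $\langle \mathrm{ad}^*_\xi\mu,\eta\rangle=\langle\mu,[\xi,\eta]\rangle$. The semidirect product Lie algebra $\mathfrak g\circledS\mathfrak g$ carries the bracket $$[(\xi_2,\xi_3),(\eta_2,\eta_3)]_{\mathfrak g\circledS\mathfrak g}=([\xi_2,\eta_2],\,[\xi_2,\eta_3]-[\eta_2,\xi_3]).$$ Let ${}^1TTG=(G\circledS\mathfrak g)\circledS(\mathfrak g\circledS\mathfrak g)$ be the first-kind trivialization of $TTG$, with points $(g,\xi_1,\xi_2,\xi_3)$; as a manifold it is $G\times\mathfrak g\times\mathfrak g\times\mathfrak g$. Let $L=L(g,\xi_1,\xi_2,\xi_3)$ be a smooth function on it. Write $\frac{\delta L}{\delta g}\in T_g^*G$ and $\frac{\delta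 L}{\delta\xi_i}\in\mathfrak g^*$ for its partial derivatives, and $T^*R_g\frac{\delta L}{\delta g}=\frac{\delta L}{\delta g}\circ T_eR_g\in\mathfrak g^*$. Let $a<b$ and let $c=(g,\xi_1,\xi_2,\xi_3):[a,b]\to{}^1TTG$ be a smooth curve. Call $c$ an extremal of the action $\int_a^bL\,dt$ if for every smooth curve $(\eta_2,\eta_3):[a,b]\to\mathfrak g\circledS\mathfrak g$ that vanishes at $a$ and $b$, and every smooth one-parameter family $c_s$ ($|s|<\varepsilon$) of curves $[a,b]\to{}^1TTG$ with $c_0=c$ whose variation field $\delta=\partial_s|_{s=0}$ is $$\delta g=T_eR_g\,\eta_2,\qquad \delta\xi_1=\eta_3+[\xi_1,\eta_2]$$ (the right-trivialized variation of $(g,\xi_1)$) and $$\delta(\xi_2,\xi_3)=\tfrac{d}{dt}(\eta_2,\eta_3)+[(\xi_2,\xi_3),(\eta_2,\eta_3)]_{\mathfrak g\circledS\mathfrak g}$$ (the reduced variational principle on $\mathfrak g\circledS\mathfrak g$), one has $\frac{d}{ds}\big|_{s=0}\int_a^bL(c_s(t))\,dt=0$. Then $c$ is an extremal if and only if along $c$,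 for all $t\in[a,b]$ (one-sided derivatives at the end points), the trivialized Euler–Lagrange equations hold: $$\frac{d}{dt}\frac{\delta L}{\delta\xi_2}=T^*R_g\frac{\delta L}{\delta g}+\mathrm{ad}^*_{\xi_1}\frac{\delta L}{\delta\xi_1}+\mathrm{ad}^*_{\xi_2}\frac{\delta L}{\delta\xi_2}+\mathrm{ad}^*_{\xi_3}\frac{\delta L}{\delta\xi_3},$$ $$\frac{d}{dt}\frac{\delta L}{\delta\xi_3}=\frac{\delta L}{\delta\xi_1}+\mathrm{ad}^*_{\xi_2}\frac{\delta L}{\delta\xi_3}.$$ -/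

import Mathlib

open Set
open scoped Manifold ContDiff

noncomputable section

namespace TrivializedTTG

/-! `G` is a real Lie group whose charts take values in the finite-dimensional space `𝔤`.
The tangent space of `G` at any point is, by Mathlib's definition of `TangentSpace`, a copy of the
model space; in particular `𝔤` *is* the tangent space `T_e G`, the vector space underlying the Lie
algebra of `G`. -/

variable {𝔤 : Type*} [NormedAddCommGroup 𝔤] [NormedSpace ℝ 𝔤]
  (G : Type*) [TopologicalSpace G] [ChartedSpace 𝔤 G] [Group G]

/-- The tangent map `T_e R_g : 𝔤 → T_g G` of the right translation `R_g h = h g`. -/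
def rightTranslate {G : Type*} [TopologicalSpace G] [ChartedSpace 𝔤 G] [Group G] (g : G) :
    𝔤 →L[ℝ] TangentSpace 𝓘(ℝ, 𝔤) g :=
  mfderiv 𝓘(ℝ, 𝔤) 𝓘(ℝ, 𝔤) (fun h : G => h * g) 1

/-- The right invariant vector field `X_ξ(g) = T_e R_g ξ`. -/
def rightInvariantField (ξ : 𝔤) (g : G) : TangentSpace 𝓘(ℝ, 𝔤) g :=
  rightTranslate g ξ

/-- The Lie algebra bracket `[ξ, η]` on `𝔤 = T_e G`: the value at `e` of the Jacobi-Lie bracket of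
the right invariant vector fields `X_ξ` and `X_η`. (It is the negative of the bracket given by
left invariant fields.) -/
def bracket (ξ η : 𝔤) : 𝔤 :=
  VectorField.mlieBracket 𝓘(ℝ, 𝔤) (rightInvariantField G ξ) (rightInvariantField G η) (1 : G)

theorem mdifferentiable_rightInvariantField [LieGroup 𝓘(ℝ, 𝔤) ∞ G] (ξ : 𝔤) :
    MDifferentiable 𝓘(ℝ, 𝔤) 𝓘(ℝ, 𝔤).tangent
      (fun g : G => (⟨g, rightInvariantField G ξ g⟩ : TangentBundle 𝓘(ℝ, 𝔤) G)) := by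
  let fg : G → TangentBundle 𝓘(ℝ, 𝔤) G := fun g ↦ Bundle.TotalSpace.mk' 𝔤 g 0
  have sfg : ContMDiff 𝓘(ℝ, 𝔤) 𝓘(ℝ, 𝔤).tangent 1 fg := Bundle.contMDiff_zeroSection _ _
  let fv : G → TangentBundle 𝓘(ℝ, 𝔤) G := fun _ ↦ Bundle.TotalSpace.mk' 𝔤 1 ξ
  have sfv : ContMDiff 𝓘(ℝ, 𝔤) 𝓘(ℝ, 𝔤).tangent 1 fv := contMDiff_const
  let F₁ : G → (TangentBundle 𝓘(ℝ, 𝔤) G × TangentBundle 𝓘(ℝ, 𝔤) G) := fun g ↦ (fv g, fg g)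
  have S₁ : ContMDiff 𝓘(ℝ, 𝔤) (𝓘(ℝ, 𝔤).tangent.prod 𝓘(ℝ, 𝔤).tangent) 1 F₁ := sfv.prodMk sfg
  let F₂ : (TangentBundle 𝓘(ℝ, 𝔤) G × TangentBundle 𝓘(ℝ, 𝔤) G) →
      TangentBundle (𝓘(ℝ, 𝔤).prod 𝓘(ℝ, 𝔤)) (G × G) :=
    (equivTangentBundleProd 𝓘(ℝ, 𝔤) G 𝓘(ℝ, 𝔤) G).symm
  have S₂ : ContMDiff (𝓘(ℝ, 𝔤).tangent.prod 𝓘(ℝ, 𝔤).tangent)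
      (𝓘(ℝ, 𝔤).prod 𝓘(ℝ, 𝔤)).tangent 1 F₂ := contMDiff_equivTangentBundleProd_symm
  have hmul : ContMDiff (𝓘(ℝ, 𝔤).prod 𝓘(ℝ, 𝔤)) 𝓘(ℝ, 𝔤) ∞ (fun p : G × G ↦ p.1 * p.2) :=
    contMDiff_mul 𝓘(ℝ, 𝔤) ∞
  let F₃ : TangentBundle (𝓘(ℝ, 𝔤).prod 𝓘(ℝ, 𝔤)) (G × G) → TangentBundle 𝓘(ℝ, 𝔤) G :=
    tangentMap (𝓘(ℝ, 𝔤).prod 𝓘(ℝ, 𝔤)) 𝓘(ℝ, 𝔤) (fun p : G × G ↦ p.1 * p.2)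
  have S₃ : ContMDiff (𝓘(ℝ, 𝔤).prod 𝓘(ℝ, 𝔤)).tangent 𝓘(ℝ, 𝔤).tangent 1 F₃ :=
    ContMDiff.contMDiff_tangentMap hmul (by norm_cast)
  let S := (S₃.comp S₂).comp S₁
  have key : ContMDiff 𝓘(ℝ, 𝔤) 𝓘(ℝ, 𝔤).tangent 1
      (fun g : G => (⟨g, rightInvariantField G ξ g⟩ : TangentBundle 𝓘(ℝ, 𝔤) G)) := by
    convert! S with g
    · simp [F₁, F₂, F₃, fg, fv]
    · change (mfderiv 𝓘(ℝ, 𝔤) 𝓘(ℝ, 𝔤) (fun h : G => h * g) 1 : 𝔤 →L[ℝ] 𝔤) ξ =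
        (mfderiv (𝓘(ℝ, 𝔤).prod 𝓘(ℝ, 𝔤)) 𝓘(ℝ, 𝔤) (fun p : G × G ↦ p.1 * p.2) (1, g) :
          𝔤 × 𝔤 →L[ℝ] 𝔤) (ξ, 0)
      refine Eq.trans ?_ (mfderiv_prod_eq_add_apply (v := ((ξ, 0) : 𝔤 × 𝔤))
        (hmul.mdifferentiableAt (x := (1, g)) (by simp))).symm
      let A : 𝔤 →L[ℝ] 𝔤 := mfderiv 𝓘(ℝ, 𝔤) 𝓘(ℝ, 𝔤) (fun h : G => h * g) 1
      let B : 𝔤 →L[ℝ] 𝔤 := mfderiv 𝓘(ℝ, 𝔤) 𝓘(ℝ, 𝔤) (fun z : G => 1 * z) g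
      have h0 : A ξ = A ξ + B 0 := by rw [map_zero, add_zero]
      exact h0
  exact key.mdifferentiable one_ne_zero

theorem bracket_add_right [LieGroup 𝓘(ℝ, 𝔤) ∞ G] [CompleteSpace 𝔤] (ξ η ζ : 𝔤) :
    bracket G ξ (η + ζ) = bracket G ξ η + bracket G ξ ζ := by
  have h : rightInvariantField G (η + ζ) = rightInvariantField G η + rightInvariantField G ζ := by
    funext g; exact map_add (rightTranslate g) η ζ
  unfold bracket
  rw [h]
  exact VectorField.mlieBracket_add_right
    (mdifferentiable_rightInvariantField G η 1) (mdifferentiable_rightInvariantField G ζ 1)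

theorem bracket_smul_right [LieGroup 𝓘(ℝ, 𝔤) ∞ G] [CompleteSpace 𝔤] (r : ℝ) (ξ η : 𝔤) :
    bracket G ξ (r • η) = r • bracket G ξ η := by
  have h : rightInvariantField G (r • η) = r • rightInvariantField G η := by
    funext g; exact map_smul (rightTranslate g) r η
  unfold bracket
  rw [h]
  exact VectorField.mlieBracket_const_smul_right
    (mdifferentiable_rightInvariantField G η 1)

/-- The infinitesimal adjoint action `ad_ξ η = [ξ, η]`. -/
def ad [FiniteDimensional ℝ 𝔤] [LieGroup 𝓘(ℝ, 𝔤) ∞ G] (ξ : 𝔤) : 𝔤 →L[ℝ] 𝔤 :=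
  haveI : CompleteSpace 𝔤 := FiniteDimensional.complete ℝ 𝔤
  LinearMap.toContinuousLinearMap
    { toFun := fun η => bracket G ξ η
      map_add' := bracket_add_right G ξ
      map_smul' := fun r η => bracket_smul_right G r ξ η }

/-- The infinitesimal coadjoint action `ad*_ξ` on `𝔤*`, the linear algebraic dual of `ad_ξ`:
`⟨ad*_ξ μ, η⟩ = ⟨μ, [ξ, η]⟩`. -/
def coad [FiniteDimensional ℝ 𝔤] [LieGroup 𝓘(ℝ, 𝔤) ∞ G] (ξ : 𝔤) (μ : 𝔤 →L[ℝ] ℝ) : 𝔤 →L[ℝ] ℝ :=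
  μ.comp (ad G ξ)

/-- The bracket of the semidirect product Lie algebra `𝔤 ⋉ 𝔤` of the group `G ⋉ 𝔤`:
`[(ξ₂, ξ₃), (η₂, η₃)] = ([ξ₂, η₂], [ξ₂, η₃] - [η₂, ξ₃])`. -/
def semidirectBracket (ξ η : 𝔤 × 𝔤) : 𝔤 × 𝔤 :=
  (bracket G ξ.1 η.1, bracket G ξ.1 η.2 - bracket G η.1 ξ.2)

/-- The manifold underlying the first-kind trivialization `¹TTG = (G ⋉ 𝔤) ⋉ (𝔤 ⋉ 𝔤)` of the
iterated tangent bundle; its points are `((g, ξ₁), (ξ₂, ξ₃))`. -/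
abbrev TTG (𝔤 G : Type*) : Type _ := (G × 𝔤) × (𝔤 × 𝔤)

/-- The (product) model with corners of the manifold `¹TTG`. -/
abbrev modelTTG (𝔤 : Type*) [NormedAddCommGroup 𝔤] [NormedSpace ℝ 𝔤] :=
  (𝓘(ℝ, 𝔤).prod 𝓘(ℝ, 𝔤)).prod (𝓘(ℝ, 𝔤).prod 𝓘(ℝ, 𝔤))

variable {G}

/-- `T*R_g (δL/δg) ∈ 𝔤*`: the partial differential of `L` in the group variable, an element of
`T_g* G`, pulled back to `𝔤*` by `T_e R_g`. -/
def pullbackDerivG (L : TTG 𝔤 G → ℝ) (p : TTG 𝔤 G) : 𝔤 →L[ℝ] ℝ :=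
  ContinuousLinearMap.comp
    (mfderiv 𝓘(ℝ, 𝔤) 𝓘(ℝ, ℝ) (fun h : G => L ((h, p.1.2), p.2)) p.1.1 :
      TangentSpace 𝓘(ℝ, 𝔤) p.1.1 →L[ℝ] ℝ)
    (rightTranslate p.1.1)

/-- The partial derivative `δL/δξ₁ ∈ 𝔤*`. -/
def deriv₁ (L : TTG 𝔤 G → ℝ) (p : TTG 𝔤 G) : 𝔤 →L[ℝ] ℝ :=
  fderiv ℝ (fun x : 𝔤 => L ((p.1.1, x), p.2)) p.1.2

/-- The partial derivative `δL/δξ₂ ∈ 𝔤*`. -/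
def deriv₂ (L : TTG 𝔤 G → ℝ) (p : TTG 𝔤 G) : 𝔤 →L[ℝ] ℝ :=
  fderiv ℝ (fun x : 𝔤 => L (p.1, (x, p.2.2))) p.2.1

/-- The partial derivative `δL/δξ₃ ∈ 𝔤*`. -/
def deriv₃ (L : TTG 𝔤 G → ℝ) (p : TTG 𝔤 G) : 𝔤 →L[ℝ] ℝ :=
  fderiv ℝ (fun x : 𝔤 => L (p.1, (p.2.1, x))) p.2.2

/-- `Γ` is a smooth one-parameter family `s ↦ Γ (s, ·)` of curves `[a, b] → ¹TTG`, defined for `s`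
near `0`, with `Γ (0, ·) = c`, whose variation field `∂Γ/∂s` at `s = 0` is generated by the curve
`η = (η₂, η₃)` in `𝔤 ⋉ 𝔤`:
* `(g, ξ₁)` is varied by the right trivialized variation
  `δg = T R_g η₂`, `δξ₁ = η₃ + [ξ₁, η₂]`;
* `(ξ₂, ξ₃)` is varied according to the reduced variational principle
  `δ(ξ₂, ξ₃) = d/dt (η₂, η₃) + [(ξ₂, ξ₃), (η₂, η₃)]` on `𝔤 ⋉ 𝔤`. -/
structure IsVariation (a b : ℝ) (c : ℝ → TTG 𝔤 G) (η : ℝ → 𝔤 × 𝔤) (Γ : ℝ × ℝ → TTG 𝔤 G) :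
    Prop where
  smooth : ∃ ε > 0, ContMDiffOn 𝓘(ℝ, ℝ × ℝ) (modelTTG 𝔤) ∞ Γ (Ioo (-ε) ε ×ˢ Icc a b)
  initial : ∀ t ∈ Icc a b, Γ (0, t) = c t
  var_g : ∀ t ∈ Icc a b,
    mfderiv 𝓘(ℝ, ℝ) 𝓘(ℝ, 𝔤) (fun s : ℝ => (Γ (s, t)).1.1) 0 (1 : ℝ)
      = rightTranslate (Γ (0, t)).1.1 (η t).1
  var_ξ₁ : ∀ t ∈ Icc a b,
    deriv (fun s : ℝ => (Γ (s, t)).1.2) 0 = (η t).2 + bracket G (c t).1.2 (η t).1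
  var_ξ₂₃ : ∀ t ∈ Icc a b,
    deriv (fun s : ℝ => (Γ (s, t)).2) 0
      = derivWithin η (Icc a b) t + semidirectBracket G (c t).2 (η t)

/-- The curve `c : [a, b] → ¹TTG` is an extremal of the action `∫ L dt`: the action is stationary
at `c` along every variation generated by a smooth curve `η = (η₂, η₃)` in `𝔤 ⋉ 𝔤` that vanishes
at both end points. -/
def IsExtremal (L : TTG 𝔤 G → ℝ) (a b : ℝ) (c : ℝ → TTG 𝔤 G) : Prop :=
  ∀ (η : ℝ → 𝔤 × 𝔤) (Γ : ℝ × ℝ → TTG 𝔤 G),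
    ContDiffOn ℝ ∞ η (Icc a b) → η a = 0 → η b = 0 → IsVariation a b c η Γ →
      HasDerivAt (fun s : ℝ => ∫ t in a..b, L (Γ (s, t))) 0 0

end TrivializedTTG

end

/-! The chain rule pairs the four partial derivatives of `L` with the prescribed variations. The
coefficients of `η₂` and `η₃` then collect into `force₂` and `force₃`. The term `-[η₂, ξ₃]` of the
semidirect bracket becomes `[ξ₃, η₂]` by antisymmetry and so gives the `ad*_{ξ₃}` term. What remains
pairs `δL/δξ₂` and `δL/δξ₃` with `d/dt (η₂, η₃)`. Integration by parts moves this derivative onto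
the momenta, with no boundary term because `η` vanishes at both ends (`hasDerivAt_action`). The
Euler–Lagrange equations therefore make the action stationary.

For the converse, extremality says something about `η` only if `η` is generated by an actual family
of curves. `exists_isVariation` builds one for every smooth `η`: the four components of a point are
independent coordinates, so each can be varied separately with the required velocity. The
fundamental lemma, applied in one direction of `𝔤` at a time, then gives the equations up to the end
points. Of the bracket, only bilinearity and antisymmetry are needed, not the Jacobi identity. -/

noncomputable section

namespace TrivializedTTG

/-! ### Smoothness of the partial derivatives and the chain rule -/

variable {𝔤 : Type*} [NormedAddCommGroup 𝔤] [NormedSpace ℝ 𝔤]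
  {G : Type*} [TopologicalSpace G] [ChartedSpace 𝔤 G] {L : TTG 𝔤 G → ℝ}

/-- The derivative in a vector space variable of a smooth function of several variables is
smooth. -/
theorem contMDiff_fderiv_param {E H N : Type*} [NormedAddCommGroup E] [NormedSpace ℝ E]
    [TopologicalSpace H] {J : ModelWithCorners ℝ E H} [TopologicalSpace N] [ChartedSpace H N]
    [IsManifold J 1 N] {f : N → 𝔤 → ℝ} {g : N → 𝔤}
    (hf : ContMDiff (J.prod 𝓘(ℝ, 𝔤)) 𝓘(ℝ, ℝ) ∞ (Function.uncurry f))
    (hg : ContMDiff J 𝓘(ℝ, 𝔤) ∞ g) :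
    ContMDiff J 𝓘(ℝ, 𝔤 →L[ℝ] ℝ) ∞ (fun p => fderiv ℝ (f p) (g p)) := by
  intro p
  have h := ContMDiffAt.mfderiv (m := ∞) (x₀ := p) f g hf.contMDiffAt hg.contMDiffAt (by simp)
  simp only [inTangentCoordinates_model_space, mfderiv_eq_fderiv] at h
  exact h

theorem contMDiff_deriv₁ [IsManifold 𝓘(ℝ, 𝔤) 1 G]
    (hL : ContMDiff (modelTTG 𝔤) 𝓘(ℝ, ℝ) ∞ L) :
    ContMDiff (modelTTG 𝔤) 𝓘(ℝ, 𝔤 →L[ℝ] ℝ) ∞ (deriv₁ L) := by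
  refine contMDiff_fderiv_param (f := fun (p : TTG 𝔤 G) x => L ((p.1.1, x), p.2))
    (g := fun p => p.1.2) (hL.comp ?_) (contMDiff_snd.comp contMDiff_fst)
  exact ((contMDiff_fst.comp (contMDiff_fst.comp contMDiff_fst)).prodMk contMDiff_snd).prodMk
    (contMDiff_snd.comp contMDiff_fst)

theorem contMDiff_deriv₂ [IsManifold 𝓘(ℝ, 𝔤) 1 G]
    (hL : ContMDiff (modelTTG 𝔤) 𝓘(ℝ, ℝ) ∞ L) :
    ContMDiff (modelTTG 𝔤) 𝓘(ℝ, 𝔤 →L[ℝ] ℝ) ∞ (deriv₂ L) := by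
  refine contMDiff_fderiv_param (f := fun (p : TTG 𝔤 G) x => L (p.1, (x, p.2.2)))
    (g := fun p => p.2.1) (hL.comp ?_) (contMDiff_fst.comp contMDiff_snd)
  exact (contMDiff_fst.comp contMDiff_fst).prodMk
    (contMDiff_snd.prodMk (contMDiff_snd.comp (contMDiff_snd.comp contMDiff_fst)))

theorem contMDiff_deriv₃ [IsManifold 𝓘(ℝ, 𝔤) 1 G]
    (hL : ContMDiff (modelTTG 𝔤) 𝓘(ℝ, ℝ) ∞ L) :
    ContMDiff (modelTTG 𝔤) 𝓘(ℝ, 𝔤 →L[ℝ] ℝ) ∞ (deriv₃ L) := by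
  refine contMDiff_fderiv_param (f := fun (p : TTG 𝔤 G) x => L (p.1, (p.2.1, x)))
    (g := fun p => p.2.2) (hL.comp ?_) (contMDiff_snd.comp contMDiff_snd)
  exact (contMDiff_fst.comp contMDiff_fst).prodMk
    ((contMDiff_fst.comp (contMDiff_snd.comp contMDiff_fst)).prodMk contMDiff_snd)

variable [Group G]

theorem bracket_antisymm (ξ η : 𝔤) : bracket G ξ η = -bracket G η ξ :=
  VectorField.mlieBracket_swap_apply

theorem ad_apply [FiniteDimensional ℝ 𝔤] [LieGroup 𝓘(ℝ, 𝔤) ∞ G] (ξ η : 𝔤) :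
    ad G ξ η = bracket G ξ η := rfl

/-- Linearity in the second slot is built into `ad`. Antisymmetry transfers it to the first slot,
and a linear map on a finite-dimensional space is smooth. -/
theorem contDiff_ad [FiniteDimensional ℝ 𝔤] [LieGroup 𝓘(ℝ, 𝔤) ∞ G] :
    ContDiff ℝ ∞ (ad G : 𝔤 → 𝔤 →L[ℝ] 𝔤) := by
  have key : ∀ ξ η : 𝔤, ad G ξ η = -ad G η ξ := fun ξ η => bracket_antisymm ξ η
  let A : 𝔤 →ₗ[ℝ] 𝔤 →L[ℝ] 𝔤 :=
    { toFun := ad G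
      map_add' := fun ξ η => by
        ext ζ
        rw [add_apply, key, key ξ, key η, map_add, neg_add]
      map_smul' := fun r ξ => by
        ext ζ
        rw [smul_apply, key, key ξ, map_smul, RingHom.id_apply, smul_neg] }
  exact (LinearMap.toContinuousLinearMap A).contDiff

/-- `T*R_g (δL/δg)` is the differential at the identity of `h ↦ L(hg, ξ₁, ξ₂, ξ₃)`. -/
theorem pullbackDerivG_eq_mfderiv [LieGroup 𝓘(ℝ, 𝔤) ∞ G] 
    (hL : ContMDiff (modelTTG 𝔤) 𝓘(ℝ, ℝ) ∞ L) (p : TTG 𝔤 G) :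
    pullbackDerivG L p =
      mfderiv 𝓘(ℝ, 𝔤) 𝓘(ℝ, ℝ) (fun h : G => L ((h * p.1.1, p.1.2), p.2)) 1 := by
  have h1 : MDifferentiable 𝓘(ℝ, 𝔤) 𝓘(ℝ, ℝ) (fun h : G => L ((h, p.1.2), p.2)) :=
    ContMDiff.mdifferentiable (n := ∞)
      (hL.comp ((contMDiff_id.prodMk contMDiff_const).prodMk contMDiff_const)) (by simp)
  have h2 : MDifferentiable 𝓘(ℝ, 𝔤) 𝓘(ℝ, 𝔤) (fun h : G => h * p.1.1) :=
    (contMDiff_mul_right (I := 𝓘(ℝ, 𝔤)) (n := ∞)).mdifferentiable (by simp)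
  have h3 := mfderiv_comp (1 : G) (h1 _) (h2 1)
  -- The chain rule differentiates at `1 * g`, which is only propositionally equal to `g`. Tangent
  -- spaces at both points are copies of `𝔤`, so the differentials can be compared there.
  have e : ∀ q : G, q = p.1.1 →
      (mfderiv 𝓘(ℝ, 𝔤) 𝓘(ℝ, ℝ) (fun h : G => L ((h, p.1.2), p.2)) p.1.1 : 𝔤 →L[ℝ] ℝ) =
        mfderiv 𝓘(ℝ, 𝔤) 𝓘(ℝ, ℝ) (fun h : G => L ((h, p.1.2), p.2)) q := by
    rintro _ rfl; rfl
  exact (congrArg (fun A : 𝔤 →L[ℝ] ℝ => A.comp (rightTranslate p.1.1 : 𝔤 →L[ℝ] 𝔤))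
    (e _ (one_mul _))).trans h3.symm

/-- Written as a differential at the fixed point `1`, the pullback no longer involves a moving
tangent space, so smooth dependence of `mfderiv` on parameters applies. -/
theorem contMDiff_pullbackDerivG [LieGroup 𝓘(ℝ, 𝔤) ∞ G]
    (hL : ContMDiff (modelTTG 𝔤) 𝓘(ℝ, ℝ) ∞ L) :
    ContMDiff (modelTTG 𝔤) 𝓘(ℝ, 𝔤 →L[ℝ] ℝ) ∞ (pullbackDerivG L) := by
  intro p
  let f : TTG 𝔤 G → G → ℝ := fun p h => L ((h * p.1.1, p.1.2), p.2)
  have hmul : ContMDiff ((modelTTG 𝔤).prod 𝓘(ℝ, 𝔤)) 𝓘(ℝ, 𝔤) ∞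
      (fun q : TTG 𝔤 G × G => q.2 * q.1.1.1) :=
    contMDiff_snd.mul (contMDiff_fst.comp (contMDiff_fst.comp contMDiff_fst))
  have hf : ContMDiff ((modelTTG 𝔤).prod 𝓘(ℝ, 𝔤)) 𝓘(ℝ, ℝ) ∞ (Function.uncurry f) :=
    hL.comp ((hmul.prodMk (contMDiff_snd.comp (contMDiff_fst.comp contMDiff_fst))).prodMk
      (contMDiff_snd.comp contMDiff_fst))
  have h := ContMDiffAt.mfderiv (m := ∞) (x₀ := p) f (fun _ => (1 : G)) hf.contMDiffAt
    contMDiffAt_const (by simp)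
  refine h.congr_of_eventuallyEq (Filter.Eventually.of_forall fun q => ?_)
  refine (pullbackDerivG_eq_mfderiv hL q).trans (Eq.trans ?_ (inTangentCoordinates_eq
    (I := 𝓘(ℝ, 𝔤)) (I' := 𝓘(ℝ, ℝ)) (fun _ : TTG 𝔤 G => (1 : G)) (fun q => f q 1)
    (fun q => mfderiv 𝓘(ℝ, 𝔤) 𝓘(ℝ, ℝ) (f q) 1) (x₀ := p) (x := q)
    (mem_chart_source _ _) (by rw [chartAt_self_eq]; exact mem_univ _)).symm)
  let A : 𝔤 →L[ℝ] ℝ := mfderiv 𝓘(ℝ, 𝔤) 𝓘(ℝ, ℝ) (f q) 1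
  refine ContinuousLinearMap.ext fun v : 𝔤 => ?_
  -- The base point is constantly `1`, so the tangent coordinates compare a chart with itself and
  -- both coordinate changes are identities.
  have e1 := (tangentBundleCore 𝓘(ℝ, 𝔤) G).coordChange_self (achart 𝔤 (1 : G)) 1
    (mem_chart_source 𝔤 (1 : G)) v
  have e2 := (tangentBundleCore 𝓘(ℝ, ℝ) ℝ).coordChange_self (achart ℝ (0 : ℝ)) (f q 1)
    (by change _ ∈ (chartAt ℝ (0 : ℝ)).source; rw [chartAt_self_eq]; exact mem_univ _) (A v)
  exact e2.symm.trans (congrArg (fun w : 𝔤 => ((tangentBundleCore 𝓘(ℝ, ℝ) ℝ).coordChange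
    (achart ℝ (0 : ℝ)) (achart ℝ (0 : ℝ)) (f q 1)) (A w)) e1.symm)

/-- The differential of `L` is the sum of its partial differentials. -/
theorem mfderiv_eq_sum_partials {p : TTG 𝔤 G}
    (hL : MDifferentiable (modelTTG 𝔤) 𝓘(ℝ, ℝ) L) (v x y z : 𝔤) :
    (mfderiv (modelTTG 𝔤) 𝓘(ℝ, ℝ) L p : (𝔤 × 𝔤) × (𝔤 × 𝔤) →L[ℝ] ℝ) 
        (((rightTranslate p.1.1 : 𝔤 →L[ℝ] 𝔤) v, x), (y, z)) =
      pullbackDerivG L p v + deriv₁ L p x + deriv₂ L p y + deriv₃ L p z := by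
  have hl : MDifferentiable (𝓘(ℝ, 𝔤).prod 𝓘(ℝ, 𝔤)) 𝓘(ℝ, ℝ)
      (fun q : G × 𝔤 => L (q, p.2)) :=
    hL.comp (mdifferentiable_id.prodMk mdifferentiable_const)
  have hr : MDifferentiable (𝓘(ℝ, 𝔤).prod 𝓘(ℝ, 𝔤)) 𝓘(ℝ, ℝ)
      (fun q : 𝔤 × 𝔤 => L (p.1, q)) :=
    hL.comp (mdifferentiable_const.prodMk mdifferentiable_id)
  set u : 𝔤 := (rightTranslate p.1.1 : 𝔤 →L[ℝ] 𝔤) v with hu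
  have h0 := mfderiv_prod_eq_add_apply (v := (((u, x), (y, z)) : (𝔤 × 𝔤) × (𝔤 × 𝔤))) (hL p)
  have h1 := mfderiv_prod_eq_add_apply (v := ((u, x) : 𝔤 × 𝔤)) (hl p.1)
  have h2 := mfderiv_prod_eq_add_apply (v := ((y, z) : 𝔤 × 𝔤)) (hr p.2)
  simp only [mfderiv_eq_fderiv] at h1 h2
  have add_congr : ∀ {r r' t t' : ℝ}, r = r' → t = t' → r + t = r' + t' := by
    rintro _ _ _ _ rfl rfl; rfl
  exact h0.trans ((add_congr h1 h2).trans (add_assoc _ _ _).symm)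

/-- The group velocity enters through its right trivialization `v`, which is the form in which
`IsVariation` prescribes it. -/
theorem hasDerivAt_comp_curve (hL : MDifferentiable (modelTTG 𝔤) 𝓘(ℝ, ℝ) L)
    {γ : ℝ → TTG 𝔤 G} {s : ℝ} (hγ : MDifferentiableAt 𝓘(ℝ, ℝ) (modelTTG 𝔤) γ s)
    {v : 𝔤} (hv : mfderiv 𝓘(ℝ, ℝ) 𝓘(ℝ, 𝔤) (fun s => (γ s).1.1) s (1 : ℝ)
      = rightTranslate (γ s).1.1 v) :
    HasDerivAt (fun s => L (γ s))
      (pullbackDerivG L (γ s) v + deriv₁ L (γ s) (deriv (fun s => (γ s).1.2) s)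
        + deriv₂ L (γ s) (deriv (fun s => (γ s).2) s).1
        + deriv₃ L (γ s) (deriv (fun s => (γ s).2) s).2) s := by
  have h1 : MDifferentiableAt 𝓘(ℝ, ℝ) (𝓘(ℝ, 𝔤).prod 𝓘(ℝ, 𝔤)) (fun s => (γ s).1) s := hγ.fst
  have h2 : MDifferentiableAt 𝓘(ℝ, ℝ) (𝓘(ℝ, 𝔤).prod 𝓘(ℝ, 𝔤)) (fun s => (γ s).2) s := hγ.snd
  have hg : MDifferentiableAt 𝓘(ℝ, ℝ) 𝓘(ℝ, 𝔤) (fun s => (γ s).1.1) s := h1.fst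
  have hx : MDifferentiableAt 𝓘(ℝ, ℝ) 𝓘(ℝ, 𝔤) (fun s => (γ s).1.2) s := h1.snd
  have hy : MDifferentiableAt 𝓘(ℝ, ℝ) 𝓘(ℝ, 𝔤) (fun s => (γ s).2.1) s := h2.fst
  have hz : MDifferentiableAt 𝓘(ℝ, ℝ) 𝓘(ℝ, 𝔤) (fun s => (γ s).2.2) s := h2.snd
  have hcomp : HasMFDerivAt 𝓘(ℝ, ℝ) 𝓘(ℝ, ℝ) (fun s => L (γ s)) s _ :=
    (hL (γ s)).hasMFDerivAt.comp s
      ((hg.hasMFDerivAt.prodMk hx.hasMFDerivAt).prodMk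
        (hy.hasMFDerivAt.prodMk hz.hasMFDerivAt))
  have hdiff : DifferentiableAt ℝ (fun s => L (γ s)) s := hcomp.mdifferentiableAt.differentiableAt
  have hder := congrArg (fun A : ℝ →L[ℝ] ℝ => A 1) hcomp.mfderiv
  rw [mfderiv_eq_fderiv] at hder
  refine hdiff.hasDerivAt.congr_deriv (hder.trans ?_)
  have hyd : DifferentiableAt ℝ (fun s => (γ s).2.1) s := hy.differentiableAt
  have hzd : DifferentiableAt ℝ (fun s => (γ s).2.2) s := hz.differentiableAt
  have hyz : deriv (fun s => (γ s).2) s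
      = (deriv (fun s => (γ s).2.1) s, deriv (fun s => (γ s).2.2) s) :=
    (hyd.hasDerivAt.prodMk hzd.hasDerivAt).deriv
  have toM : ∀ f : ℝ → 𝔤,
      deriv f s = (mfderiv 𝓘(ℝ, ℝ) 𝓘(ℝ, 𝔤) f s : ℝ →L[ℝ] 𝔤) (1 : ℝ) := fun f => by
    rw [mfderiv_eq_fderiv]; rfl
  rw [hyz, toM, toM, toM]
  refine Eq.trans ?_ (mfderiv_eq_sum_partials hL v _ _ _)
  rw [← hv]
  rfl

end TrivializedTTG

/-! ### Calculus on a compact interval -/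

namespace TrivializedTTG

/-- Differentiation under the integral sign along a compact interval. -/
theorem hasDerivAt_integral_of_contDiffOn {a b ε : ℝ} (hab : a < b) (hε : 0 < ε)
    {f : ℝ × ℝ → ℝ} (hf : ContDiffOn ℝ 1 f (Ioo (-ε) ε ×ˢ Icc a b)) :
    ContinuousOn (fun t => deriv (fun s => f (s, t)) 0) (Icc a b) ∧
      HasDerivAt (fun s => ∫ t in a..b, f (s, t))
        (∫ t in a..b, deriv (fun s => f (s, t)) 0) 0 := by
  set S : Set (ℝ × ℝ) := Ioo (-ε) ε ×ˢ Icc a b with hS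
  -- The rectangle is closed in `t`, so derivatives are taken within it. In the open direction `s`
  -- they become two-sided.
  have hU : UniqueDiffOn ℝ S := isOpen_Ioo.uniqueDiffOn.prod (uniqueDiffOn_Icc hab)
  let D : ℝ × ℝ → ℝ := fun p => fderivWithin ℝ f S p (1, 0)
  have hD : ContinuousOn D S :=
    (hf.continuousOn_fderivWithin hU le_rfl).clm_apply continuousOn_const
  have hder : ∀ s ∈ Ioo (-ε) ε, ∀ t ∈ Icc a b,
      HasDerivAt (fun s => f (s, t)) (D (s, t)) s := by
    intro s hs t ht
    have h1 : HasFDerivWithinAt f (fderivWithin ℝ f S (s, t)) S (s, t) :=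
      (hf.differentiableOn one_ne_zero (s, t) ⟨hs, ht⟩).hasFDerivWithinAt
    have h2 : HasDerivWithinAt (fun s : ℝ => (s, t)) (1, 0) (Ioo (-ε) ε) s :=
      (hasDerivWithinAt_id s _).prodMk (hasDerivWithinAt_const s _ t)
    have h3 := h1.comp_hasDerivWithinAt s h2 (fun x hx => mk_mem_prod hx ht)
    exact h3.hasDerivAt (isOpen_Ioo.mem_nhds hs)
  have h0 : (0 : ℝ) ∈ Ioo (-ε) ε := ⟨by linarith, hε⟩
  have slice : ∀ s ∈ Ioo (-ε) ε, ∀ {F : ℝ × ℝ → ℝ}, ContinuousOn F S →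
      ContinuousOn (fun t => F (s, t)) (Icc a b) := fun s hs F hF =>
    hF.comp (by fun_prop) (fun t ht => mk_mem_prod hs ht)
  have hEq : ∀ t ∈ Icc a b, deriv (fun s => f (s, t)) 0 = D (0, t) :=
    fun t ht => (hder 0 h0 t ht).deriv
  have huI : uIoc a b ⊆ Icc a b := by
    rw [uIoc_of_le hab.le]; exact Ioc_subset_Icc_self
  refine ⟨(slice 0 h0 hD).congr hEq, ?_⟩
  have hint : ∫ t in a..b, deriv (fun s => f (s, t)) 0 = ∫ t in a..b, D (0, t) :=
    intervalIntegral.integral_congr fun t ht => hEq t (by rwa [uIcc_of_le hab.le] at ht)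
  rw [hint]
  have hK : IsCompact (Icc (-(ε / 2)) (ε / 2) ×ˢ Icc a b) := isCompact_Icc.prod isCompact_Icc
  have hsub : Icc (-(ε / 2)) (ε / 2) ⊆ Ioo (-ε) ε := fun s hs =>
    ⟨by linarith [hs.1], by linarith [hs.2]⟩
  -- Halving `ε` gives a compact rectangle, on which the continuous `s`-derivative is bounded; `C`
  -- is the dominating function.
  obtain ⟨C, hC⟩ := hK.exists_bound_of_continuousOn (hD.mono (prod_mono hsub subset_rfl))
  have hnhds : Icc (-(ε / 2)) (ε / 2) ∈ nhds (0 : ℝ) :=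
    Icc_mem_nhds (by linarith) (by linarith)
  have hmeas : ∀ s ∈ Ioo (-ε) ε, ∀ {F : ℝ × ℝ → ℝ}, ContinuousOn F S →
      IntervalIntegrable (fun t => F (s, t)) MeasureTheory.volume a b := fun s hs F hF =>
    ContinuousOn.intervalIntegrable (by rw [uIcc_of_le hab.le]; exact slice s hs hF)
  refine (intervalIntegral.hasDerivAt_integral_of_dominated_loc_of_deriv_le
    (F := fun s t => f (s, t)) (F' := fun s t => D (s, t)) (bound := fun _ => C)
    hnhds ?_ (hmeas 0 h0 hf.continuousOn) ?_ ?_ intervalIntegrable_const ?_).2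
  · filter_upwards [hnhds] with s hs
    exact (hmeas s (hsub hs) hf.continuousOn).def'.aestronglyMeasurable
  · exact (hmeas 0 h0 hD).def'.aestronglyMeasurable
  · exact Filter.Eventually.of_forall fun t ht s hs => hC (s, t) ⟨hs, huI ht⟩
  · exact Filter.Eventually.of_forall fun t ht s hs => hder s (hsub hs) t (huI ht)

/-- The fundamental lemma of the calculus of variations. -/
theorem eqOn_zero_of_integral_smul_eq_zero {a b : ℝ} (hab : a < b) {f : ℝ → ℝ}
    (hf : ContinuousOn f (Icc a b))
    (h : ∀ w : ℝ → ℝ, ContDiff ℝ ∞ w → w a = 0 → w b = 0 → ∫ t in a..b, w t * f t = 0) :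
    ∀ t ∈ Icc a b, f t = 0 := by
  have hae : ∀ᵐ t, t ∈ Ioo a b → f t = 0 := by
    refine isOpen_Ioo.ae_eq_zero_of_integral_contDiff_smul_eq_zero
      ((hf.mono Ioo_subset_Icc_self).locallyIntegrableOn measurableSet_Ioo) fun w hw _ hsupp => ?_
    have hout : ∀ t, t ∉ Ioo a b → w t = 0 := fun t ht =>
      image_eq_zero_of_notMem_tsupport fun h => ht (hsupp h)
    rw [← h w hw (hout a (by simp)) (hout b (by simp)),
      intervalIntegral.integral_of_le hab.le,
      MeasureTheory.setIntegral_eq_integral_of_forall_compl_eq_zero]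
    · simp only [smul_eq_mul]
    · intro t ht
      rw [hout t fun h' => ht (Ioo_subset_Ioc_self h'), zero_mul]
  have hIoo : EqOn f (fun _ => 0) (Ioo a b) := by
    refine MeasureTheory.Measure.eqOn_open_of_ae_eq (μ := MeasureTheory.volume) ?_ isOpen_Ioo
      (hf.mono Ioo_subset_Icc_self) continuousOn_const
    exact (MeasureTheory.ae_restrict_iff' measurableSet_Ioo).2 hae
  -- Compactly supported test functions see only the open interval; continuity extends the vanishing
  -- to the end points.
  exact hIoo.of_subset_closure hf continuousOn_const Ioo_subset_Icc_self
    (closure_Ioo hab.ne).ge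

end TrivializedTTG

/-! ### Construction of variations -/

namespace TrivializedTTG

variable {𝔤 : Type*} [NormedAddCommGroup 𝔤] [NormedSpace ℝ 𝔤]
  {G : Type*} [TopologicalSpace G] [ChartedSpace 𝔤 G] [Group G] [LieGroup 𝓘(ℝ, 𝔤) ∞ G]

/-- The straight line through `1` in the preferred chart, translated by `g`, has velocity
`T_e R_g v`. -/
theorem mfderiv_chart_line_mul (g : G) (v : 𝔤) :
    (mfderiv 𝓘(ℝ, ℝ) 𝓘(ℝ, 𝔤) (fun s : ℝ => (extChartAt 𝓘(ℝ, 𝔤) (1 : G)).symm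
      (extChartAt 𝓘(ℝ, 𝔤) (1 : G) 1 + s • v) * g) 0 : ℝ →L[ℝ] 𝔤) (1 : ℝ)
      = (rightTranslate g : 𝔤 →L[ℝ] 𝔤) v := by
  set φ := extChartAt 𝓘(ℝ, 𝔤) (1 : G) with hφ
  have hφ1 : φ.symm (φ 1) = 1 := extChartAt_to_inv (I := 𝓘(ℝ, 𝔤)) (1 : G)
  have hline : HasDerivAt (fun s : ℝ => φ 1 + s • v) v 0 := by
    simpa using ((hasDerivAt_id (0 : ℝ)).smul_const v).const_add (φ 1)
  have hline0 : φ 1 + (0 : ℝ) • v = φ 1 := by simp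
  have hsymm : MDifferentiableAt 𝓘(ℝ, 𝔤) 𝓘(ℝ, 𝔤) φ.symm (φ 1) := by
    have h := mdifferentiableWithinAt_extChartAt_symm (I := 𝓘(ℝ, 𝔤))
      (mem_extChartAt_target (I := 𝓘(ℝ, 𝔤)) (1 : G))
    rwa [ModelWithCorners.range_eq_univ, mdifferentiableWithinAt_univ] at h
  -- `TangentSpace` at `1` is identified with `𝔤` through this very chart, so its inverse has
  -- identity differential there.
  have hid : (mfderiv 𝓘(ℝ, 𝔤) 𝓘(ℝ, 𝔤) φ.symm (φ 1) : 𝔤 →L[ℝ] 𝔤) = ContinuousLinearMap.id ℝ 𝔤 := by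
    have h := mfderivWithin_range_extChartAt_symm (I := 𝓘(ℝ, 𝔤)) (x := (1 : G))
    rw [ModelWithCorners.range_eq_univ, mfderivWithin_univ] at h
    exact h
  have hmul : HasMFDerivAt 𝓘(ℝ, 𝔤) 𝓘(ℝ, 𝔤) (fun h : G => h * g) (φ.symm (φ 1))
      (rightTranslate g : 𝔤 →L[ℝ] 𝔤) := by
    rw [hφ1]
    exact ((contMDiff_mul_right (I := 𝓘(ℝ, 𝔤)) (n := ∞)).mdifferentiable (by simp) 1).hasMFDerivAt
  have h1 : HasMFDerivAt 𝓘(ℝ, 𝔤) 𝓘(ℝ, 𝔤) (fun x => φ.symm x * g) (φ 1 + (0 : ℝ) • v)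
      ((rightTranslate g : 𝔤 →L[ℝ] 𝔤).comp (ContinuousLinearMap.id ℝ 𝔤)) := by
    rw [hline0]
    have h := hmul.comp (φ 1) hsymm.hasMFDerivAt
    rw [← hid]
    exact h
  have h2 := h1.comp (0 : ℝ) hline.hasFDerivAt.hasMFDerivAt
  have h3 := congrArg (fun A : ℝ →L[ℝ] 𝔤 => A 1) h2.mfderiv
  refine h3.trans ?_
  change (rightTranslate g : 𝔤 →L[ℝ] 𝔤) ((1 : ℝ) • v) = _
  rw [one_smul]

variable [FiniteDimensional ℝ 𝔤]

theorem contDiffOn_bracket {s : Set ℝ} {x y : ℝ → 𝔤} (hx : ContDiffOn ℝ ∞ x s)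
    (hy : ContDiffOn ℝ ∞ y s) : ContDiffOn ℝ ∞ (fun t => bracket G (x t) (y t)) s :=
  ((contDiff_ad (G := G)).comp_contDiffOn hx).clm_apply hy

variable {a b : ℝ} {c : ℝ → TTG 𝔤 G} {η : ℝ → 𝔤 × 𝔤}

/-- Every smooth curve in `𝔤 ⋉ 𝔤` generates a variation of `c`. -/
theorem exists_isVariation (hab : a < b)
    (hc : ContMDiffOn 𝓘(ℝ, ℝ) (modelTTG 𝔤) ∞ c (Icc a b))
    (hη : ContDiffOn ℝ ∞ η (Icc a b)) : ∃ Γ : ℝ × ℝ → TTG 𝔤 G, IsVariation a b c η Γ := by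
  set φ := extChartAt 𝓘(ℝ, 𝔤) (1 : G) with hφ
  have hφ1 : φ.symm (φ 1) = 1 := extChartAt_to_inv (I := 𝓘(ℝ, 𝔤)) (1 : G)
  obtain ⟨r, hr, hball⟩ := Metric.isOpen_iff.1 (isOpen_extChartAt_target (I := 𝓘(ℝ, 𝔤)) (1 : G))
    (φ 1) (mem_extChartAt_target (I := 𝓘(ℝ, 𝔤)) (1 : G))
  obtain ⟨C, hC⟩ := isCompact_Icc.exists_bound_of_continuousOn hη.continuousOn
  have hη₂ : ContDiffOn ℝ ∞ (fun t => (η t).1) (Icc a b) := hη.fst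
  have hη₃ : ContDiffOn ℝ ∞ (fun t => (η t).2) (Icc a b) := hη.snd
  have hc₁ : ContDiffOn ℝ ∞ (fun t => (c t).1.2) (Icc a b) :=
    (contMDiff_snd.comp_contMDiffOn (contMDiff_fst.comp_contMDiffOn hc)).contDiffOn
  have hc₂ : ContDiffOn ℝ ∞ (fun t => (c t).2.1) (Icc a b) :=
    (contMDiff_fst.comp_contMDiffOn (contMDiff_snd.comp_contMDiffOn hc)).contDiffOn
  have hc₃ : ContDiffOn ℝ ∞ (fun t => (c t).2.2) (Icc a b) :=
    (contMDiff_snd.comp_contMDiffOn (contMDiff_snd.comp_contMDiffOn hc)).contDiffOn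
  have hη' : ContDiffOn ℝ ∞ (derivWithin η (Icc a b)) (Icc a b) :=
    hη.derivWithin (uniqueDiffOn_Icc hab) (by simp)
  let x : ℝ → 𝔤 := fun t => (η t).2 + bracket G (c t).1.2 (η t).1
  let y : ℝ → 𝔤 × 𝔤 := fun t => derivWithin η (Icc a b) t + semidirectBracket G (c t).2 (η t)
  have hx : ContDiffOn ℝ ∞ x (Icc a b) := hη₃.add (contDiffOn_bracket hc₁ hη₂)
  have hy : ContDiffOn ℝ ∞ y (Icc a b) := hη'.add
    ((contDiffOn_bracket hc₂ hη₂).prodMk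
      ((contDiffOn_bracket hc₂ hη₃).sub (contDiffOn_bracket hη₂ hc₃)))
  -- Only the first order in `s` matters, so the inverse chart can replace the exponential map.
  -- Multiplying on the left of `g` produces the velocity `T_e R_g η₂`; the vector components move
  -- affinely.
  let Γ : ℝ × ℝ → TTG 𝔤 G := fun p =>
    ((φ.symm (φ 1 + p.1 • (η p.2).1) * (c p.2).1.1, (c p.2).1.2 + p.1 • x p.2),
      ((c p.2).2.1 + p.1 • (y p.2).1, (c p.2).2.2 + p.1 • (y p.2).2))
  have hΓ0 : ∀ t, Γ (0, t) = c t := fun t => by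
    simp only [Γ, zero_smul, add_zero, hφ1, one_mul]
  have hCpos : 0 < |C| + 1 := by positivity
  -- Since `‖η₂‖ ≤ C`, this range of `s` keeps the line in the ball of radius `r` inside the chart
  -- target; the `+ 1` keeps the denominator positive.
  refine ⟨Γ, ⟨r / (|C| + 1), by positivity, ?_⟩, fun t _ => hΓ0 t, fun t _ => ?_,
    fun t _ => ?_, fun t _ => ?_⟩
  · set S : Set (ℝ × ℝ) := Ioo (-(r / (|C| + 1))) (r / (|C| + 1)) ×ˢ Icc a b with hS
    have hsnd : MapsTo (Prod.snd : ℝ × ℝ → ℝ) S (Icc a b) := fun p hp => hp.2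
    have lift : ∀ {z : ℝ → 𝔤}, ContDiffOn ℝ ∞ z (Icc a b) →
        ContDiffOn ℝ ∞ (fun p : ℝ × ℝ => z p.2) S := fun hz => hz.comp contDiffOn_snd hsnd
    have lin : ∀ {z w : ℝ → 𝔤}, ContDiffOn ℝ ∞ z (Icc a b) → ContDiffOn ℝ ∞ w (Icc a b) →
        ContMDiffOn 𝓘(ℝ, ℝ × ℝ) 𝓘(ℝ, 𝔤) ∞ (fun p : ℝ × ℝ => z p.2 + p.1 • w p.2) S :=
      fun hz hw => ((lift hz).add (contDiffOn_fst.smul (lift hw))).contMDiffOn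
    have hg : ContMDiffOn 𝓘(ℝ, ℝ × ℝ) 𝓘(ℝ, 𝔤) ∞ (fun p : ℝ × ℝ => (c p.2).1.1) S :=
      (contMDiff_fst.comp_contMDiffOn (contMDiff_fst.comp_contMDiffOn hc)).comp
        contDiffOn_snd.contMDiffOn hsnd
    have hline := lin (contDiffOn_const (c := φ 1)) hη₂
    have hmaps : MapsTo (fun p : ℝ × ℝ => φ 1 + p.1 • (η p.2).1) S φ.target := by
      intro p hp
      refine hball ?_
      have h1 : ‖(η p.2).1‖ ≤ |C| + 1 :=
        ((norm_fst_le _).trans (hC _ hp.2)).trans ((le_abs_self C).trans (by linarith))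
      have h2 : |p.1| < r / (|C| + 1) := abs_lt.2 hp.1
      rw [Metric.mem_ball, dist_eq_norm, add_sub_cancel_left, norm_smul, Real.norm_eq_abs]
      calc |p.1| * ‖(η p.2).1‖ ≤ |p.1| * (|C| + 1) := by gcongr
        _ < r / (|C| + 1) * (|C| + 1) := by gcongr
        _ = r := by field_simp
    have hexp := (contMDiffOn_extChartAt_symm (I := 𝓘(ℝ, 𝔤)) (n := ∞) (1 : G)).comp hline hmaps
    exact ((hexp.mul hg).prodMk (lin hc₁ hx)).prodMk ((lin hc₂ hy.fst).prodMk (lin hc₃ hy.snd))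
  · have e : ∀ p, p = c t →
        (rightTranslate (c t).1.1 : 𝔤 →L[ℝ] 𝔤) = rightTranslate p.1.1 := by
      rintro _ rfl; rfl
    exact (mfderiv_chart_line_mul (c t).1.1 (η t).1).trans
      (congrArg (fun A : 𝔤 →L[ℝ] 𝔤 => A (η t).1) (e _ (hΓ0 t)))
  · have h : HasDerivAt (fun s : ℝ => (c t).1.2 + s • x t) (x t) 0 := by
      simpa using ((hasDerivAt_id (0 : ℝ)).smul_const (x t)).const_add (c t).1.2
    exact h.deriv
  · have h : HasDerivAt (fun s : ℝ => (c t).2 + s • y t) (y t) 0 := by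
      simpa using ((hasDerivAt_id (0 : ℝ)).smul_const (y t)).const_add (c t).2
    exact h.deriv

/-! ### First variation and the Euler–Lagrange equations -/

variable {L : TTG 𝔤 G → ℝ}

/-- The right-hand side of the trivialized Euler-Lagrange equation for `δL/δξ₂`. -/
def force₂ (L : TTG 𝔤 G → ℝ) (p : TTG 𝔤 G) : 𝔤 →L[ℝ] ℝ :=
  pullbackDerivG L p + coad G p.1.2 (deriv₁ L p) + coad G p.2.1 (deriv₂ L p)
    + coad G p.2.2 (deriv₃ L p)

/-- The right-hand side of the trivialized Euler-Lagrange equation for `δL/δξ₃`. -/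
def force₃ (L : TTG 𝔤 G → ℝ) (p : TTG 𝔤 G) : 𝔤 →L[ℝ] ℝ :=
  deriv₁ L p + coad G p.2.1 (deriv₃ L p)

theorem continuous_coad {X : Type*} [TopologicalSpace X] {x : X → 𝔤} {μ : X → 𝔤 →L[ℝ] ℝ}
    (hx : Continuous x) (hμ : Continuous μ) : Continuous fun p => coad G (x p) (μ p) :=
  hμ.clm_comp ((contDiff_ad (G := G)).continuous.comp hx)

theorem continuous_force₂ (hL : ContMDiff (modelTTG 𝔤) 𝓘(ℝ, ℝ) ∞ L) :
    Continuous (force₂ L) :=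
  (((contMDiff_pullbackDerivG hL).continuous.add
    (continuous_coad (by fun_prop) (contMDiff_deriv₁ hL).continuous)).add
    (continuous_coad (by fun_prop) (contMDiff_deriv₂ hL).continuous)).add
    (continuous_coad (by fun_prop) (contMDiff_deriv₃ hL).continuous)

theorem continuous_force₃ (hL : ContMDiff (modelTTG 𝔤) 𝓘(ℝ, ℝ) ∞ L) :
    Continuous (force₃ L) :=
  (contMDiff_deriv₁ hL).continuous.add
    (continuous_coad (by fun_prop) (contMDiff_deriv₃ hL).continuous)

/-- The first variation formula, before integration by parts. -/
theorem first_variation (hab : a < b) (hL : ContMDiff (modelTTG 𝔤) 𝓘(ℝ, ℝ) ∞ L)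
    {Γ : ℝ × ℝ → TTG 𝔤 G} (hΓ : IsVariation a b c η Γ) :
    ∃ V : ℝ → ℝ, ContinuousOn V (Icc a b) ∧
      HasDerivAt (fun s => ∫ t in a..b, L (Γ (s, t))) (∫ t in a..b, V t) 0 ∧
      ∀ t ∈ Icc a b, V t = force₂ L (c t) (η t).1 + force₃ L (c t) (η t).2
        + deriv₂ L (c t) (derivWithin η (Icc a b) t).1
        + deriv₃ L (c t) (derivWithin η (Icc a b) t).2 := by
  obtain ⟨ε, hε, hsmooth⟩ := hΓ.smooth
  have hf : ContDiffOn ℝ ∞ (fun p => L (Γ p)) (Ioo (-ε) ε ×ˢ Icc a b) :=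
    (hL.comp_contMDiffOn hsmooth).contDiffOn
  obtain ⟨hV, hint⟩ := hasDerivAt_integral_of_contDiffOn hab hε (hf.of_le (by simp))
  refine ⟨_, hV, hint, fun t ht => ?_⟩
  have h0 : (0 : ℝ) ∈ Ioo (-ε) ε := ⟨by linarith, hε⟩
  have hcurve : ContMDiffOn 𝓘(ℝ, ℝ) 𝓘(ℝ, ℝ × ℝ) ∞ (fun s : ℝ => (s, t)) (Ioo (-ε) ε) :=
    (contDiff_id.prodMk contDiff_const).contDiffOn.contMDiffOn
  have hγ : MDifferentiableAt 𝓘(ℝ, ℝ) (modelTTG 𝔤) (fun s : ℝ => Γ (s, t)) 0 :=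
    ((hsmooth.comp hcurve fun s hs => mk_mem_prod hs ht).contMDiffAt
      (isOpen_Ioo.mem_nhds h0)).mdifferentiableAt (by simp)
  have h := (hasDerivAt_comp_curve (hL.mdifferentiable (by simp)) hγ (hΓ.var_g t ht)).deriv
  rw [h, hΓ.var_ξ₁ t ht, hΓ.var_ξ₂₃ t ht, hΓ.initial t ht]
  simp only [force₂, force₃, coad, semidirectBracket, add_apply,
    ContinuousLinearMap.comp_apply, ad_apply, Prod.fst_add, Prod.snd_add, map_add, map_sub]
  rw [bracket_antisymm (G := G) (η t).1 (c t).2.2, map_neg]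
  ring

/-- The first variation formula. -/
theorem hasDerivAt_action (hab : a < b) (hL : ContMDiff (modelTTG 𝔤) 𝓘(ℝ, ℝ) ∞ L)
    (hc : ContMDiffOn 𝓘(ℝ, ℝ) (modelTTG 𝔤) ∞ c (Icc a b))
    (hη : ContDiffOn ℝ ∞ η (Icc a b)) (ha : η a = 0) (hb : η b = 0)
    {Γ : ℝ × ℝ → TTG 𝔤 G} (hΓ : IsVariation a b c η Γ) :
    HasDerivAt (fun s => ∫ t in a..b, L (Γ (s, t)))
      (∫ t in a..b,
        ((force₂ L (c t) - derivWithin (fun τ => deriv₂ L (c τ)) (Icc a b) t) (η t).1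
          + (force₃ L (c t) - derivWithin (fun τ => deriv₃ L (c τ)) (Icc a b) t) (η t).2)) 0 := by
  obtain ⟨V, hV, hder, hVeq⟩ := first_variation hab hL hΓ
  have hA : ContDiffOn ℝ ∞ (fun τ => deriv₂ L (c τ)) (Icc a b) :=
    ((contMDiff_deriv₂ hL).comp_contMDiffOn hc).contDiffOn
  have hB : ContDiffOn ℝ ∞ (fun τ => deriv₃ L (c τ)) (Icc a b) :=
    ((contMDiff_deriv₃ hL).comp_contMDiffOn hc).contDiffOn
  have hU := uniqueDiffOn_Icc hab
  set A : ℝ → 𝔤 →L[ℝ] ℝ := fun τ => deriv₂ L (c τ) with hAdef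
  set B : ℝ → 𝔤 →L[ℝ] ℝ := fun τ => deriv₃ L (c τ) with hBdef
  -- `W` is the boundary term of the integration by parts: subtracting `W'` from the integrand
  -- removes the derivatives of `η`, and `W'` has integral zero.
  let W : ℝ → ℝ := fun t => A t (η t).1 + B t (η t).2
  have hWc : ContDiffOn ℝ ∞ W (Icc a b) := (hA.clm_apply hη.fst).add (hB.clm_apply hη.snd)
  have hW' : ∀ t ∈ Icc a b, derivWithin W (Icc a b) t
      = derivWithin A (Icc a b) t (η t).1 + A t (derivWithin η (Icc a b) t).1
        + (derivWithin B (Icc a b) t (η t).2 + B t (derivWithin η (Icc a b) t).2) := by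
    intro t ht
    have dη := (hη.differentiableOn (by simp) t ht).hasDerivWithinAt
    have dA := (hA.differentiableOn (by simp) t ht).hasDerivWithinAt
    have dB := (hB.differentiableOn (by simp) t ht).hasDerivWithinAt
    exact ((dA.clm_apply dη.fst).add (dB.clm_apply dη.snd)).derivWithin (hU t ht)
  have hW'c : ContinuousOn (derivWithin W (Icc a b)) (Icc a b) :=
    hWc.continuousOn_derivWithin hU (by simp)
  have hVint : IntervalIntegrable V MeasureTheory.volume a b :=
    ContinuousOn.intervalIntegrable (by rwa [uIcc_of_le hab.le])
  have hWint : IntervalIntegrable (derivWithin W (Icc a b)) MeasureTheory.volume a b :=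
    ContinuousOn.intervalIntegrable (by rwa [uIcc_of_le hab.le])
  have hW0 : ∫ t in a..b, derivWithin W (Icc a b) t = 0 := by
    rw [intervalIntegral.integral_eq_sub_of_hasDerivAt_of_le hab.le hWc.continuousOn
      (fun t ht => (hWc.differentiableOn (by simp) t
        (Ioo_subset_Icc_self ht)).hasDerivWithinAt.hasDerivAt (Icc_mem_nhds ht.1 ht.2)) hWint]
    simp [W, ha, hb]
  refine hder.congr_deriv ?_
  rw [← sub_zero (∫ t in a..b, V t), ← hW0, ← intervalIntegral.integral_sub hVint hWint]
  refine intervalIntegral.integral_congr fun t ht => ?_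
  rw [uIcc_of_le hab.le] at ht
  simp only [hVeq t ht, hW' t ht, sub_apply, hAdef, hBdef]
  ring

theorem isExtremal_iff (hab : a < b) (hL : ContMDiff (modelTTG 𝔤) 𝓘(ℝ, ℝ) ∞ L)
    (hc : ContMDiffOn 𝓘(ℝ, ℝ) (modelTTG 𝔤) ∞ c (Icc a b)) :
    IsExtremal L a b c ↔ ∀ t ∈ Icc a b,
      HasDerivWithinAt (fun τ => deriv₂ L (c τ)) (force₂ L (c t)) (Icc a b) t ∧
      HasDerivWithinAt (fun τ => deriv₃ L (c τ)) (force₃ L (c t)) (Icc a b) t := by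
  have hA : ContDiffOn ℝ ∞ (fun τ => deriv₂ L (c τ)) (Icc a b) :=
    ((contMDiff_deriv₂ hL).comp_contMDiffOn hc).contDiffOn
  have hB : ContDiffOn ℝ ∞ (fun τ => deriv₃ L (c τ)) (Icc a b) :=
    ((contMDiff_deriv₃ hL).comp_contMDiffOn hc).contDiffOn
  have hU := uniqueDiffOn_Icc hab
  constructor
  · intro hext
    have key : ∀ η : ℝ → 𝔤 × 𝔤, ContDiff ℝ ∞ η → η a = 0 → η b = 0 →
        ∫ t in a..b,
          ((force₂ L (c t) - derivWithin (fun τ => deriv₂ L (c τ)) (Icc a b) t) (η t).1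
          + (force₃ L (c t) - derivWithin (fun τ => deriv₃ L (c τ)) (Icc a b) t) (η t).2) = 0 := by
      intro η hη ha hb
      obtain ⟨Γ, hΓ⟩ := exists_isVariation hab hc hη.contDiffOn
      exact (hasDerivAt_action hab hL hc hη.contDiffOn ha hb hΓ).unique
        (hext η Γ hη.contDiffOn ha hb hΓ)
    -- Test curves `w(t) v` with `v` fixed reduce the covector equation to the scalar fundamental
    -- lemma for `R t v`.
    have vanish : ∀ {R : ℝ → 𝔤 →L[ℝ] ℝ}, ContinuousOn R (Icc a b) →
        (∀ (w : ℝ → ℝ) (v : 𝔤), ContDiff ℝ ∞ w → w a = 0 → w b = 0 →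
          ∫ t in a..b, R t (w t • v) = 0) → ∀ t ∈ Icc a b, R t = 0 := by
      intro R hR h t ht
      ext v
      refine eqOn_zero_of_integral_smul_eq_zero hab (f := fun t => R t v)
        (hR.clm_apply continuousOn_const) (fun w hw ha hb => ?_) t ht
      simpa only [map_smul, smul_eq_mul] using h w v hw ha hb
    have h₂ := vanish (((continuous_force₂ hL).comp_continuousOn hc.continuousOn).sub
      (hA.continuousOn_derivWithin hU (by simp))) fun w v hw ha hb => by
        simpa using key (fun t => (w t • v, 0)) ((hw.smul contDiff_const).prodMk contDiff_const)
          (by simp [ha]) (by simp [hb])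
    have h₃ := vanish (((continuous_force₃ hL).comp_continuousOn hc.continuousOn).sub
      (hB.continuousOn_derivWithin hU (by simp))) fun w v hw ha hb => by
        simpa using key (fun t => (0, w t • v)) (contDiff_const.prodMk (hw.smul contDiff_const))
          (by simp [ha]) (by simp [hb])
    intro t ht
    refine ⟨?_, ?_⟩
    · have := (hA.differentiableOn (by simp) t ht).hasDerivWithinAt
      rwa [← sub_eq_zero.1 (h₂ t ht)] at this
    · have := (hB.differentiableOn (by simp) t ht).hasDerivWithinAt
      rwa [← sub_eq_zero.1 (h₃ t ht)] at this
  · intro hEL η Γ hη ha hb hΓ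
    refine (hasDerivAt_action hab hL hc hη ha hb hΓ).congr_deriv ?_
    refine intervalIntegral.integral_zero_ae (Filter.Eventually.of_forall fun t ht => ?_)
    rw [uIoc_of_le hab.le] at ht
    have ht' := Ioc_subset_Icc_self ht
    rw [(hEL t ht').1.derivWithin (hU t ht'), (hEL t ht').2.derivWithin (hU t ht')]
    simp

end TrivializedTTG

end

theorem mainTheorem1
    {𝔤 : Type*} [NormedAddCommGroup 𝔤] [NormedSpace ℝ 𝔤] [FiniteDimensional ℝ 𝔤]
    {G : Type*} [TopologicalSpace G] [ChartedSpace 𝔤 G] [Group G] [LieGroup 𝓘(ℝ, 𝔤) ∞ G]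
    (L : TrivializedTTG.TTG 𝔤 G → ℝ)
    (hL : ContMDiff (TrivializedTTG.modelTTG 𝔤) 𝓘(ℝ, ℝ) ∞ L)
    (a b : ℝ) (hab : a < b)
    (c : ℝ → TrivializedTTG.TTG 𝔤 G)
    (hc : ContMDiffOn 𝓘(ℝ, ℝ) (TrivializedTTG.modelTTG 𝔤) ∞ c (Icc a b)) :
    TrivializedTTG.IsExtremal L a b c ↔
      ∀ t ∈ Icc a b,
        HasDerivWithinAt (fun τ => TrivializedTTG.deriv₂ L (c τ))
          (TrivializedTTG.pullbackDerivG L (c t)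
            + TrivializedTTG.coad G (c t).1.2 (TrivializedTTG.deriv₁ L (c t))
            + TrivializedTTG.coad G (c t).2.1 (TrivializedTTG.deriv₂ L (c t))
            + TrivializedTTG.coad G (c t).2.2 (TrivializedTTG.deriv₃ L (c t)))
          (Icc a b) t ∧
        HasDerivWithinAt (fun τ => TrivializedTTG.deriv₃ L (c τ))
          (TrivializedTTG.deriv₁ L (c t)
            + TrivializedTTG.coad G (c t).2.1 (TrivializedTTG.deriv₃ L (c t)))
          (Icc a b) t := by
  exact TrivializedTTG.isExtremal_iff hab hL hc
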